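/- Let $\mathbb{C}_+=\{z\in\mathbb{C}:\operatorname{Re}z>0\}$. For a bounded complex Radon measure $\mu$ on $[0,\infty)$ let $(\mathcal{L}\mu)(z)=\int_{[0,\infty)}e^{-sz}\,\mu(ds)$, $z\in\mathbb{C}_+$, be its Laplace transform, and let $A^1_+=A^1_+(\mathbb{C}_+)$ be the algebra of all functions $\mathcal{L}\mu$ on $\mathbb{C}_+$, with the norm $\|\mathcal{L}\mu\|=|\mu|([0,\infty))$ (total variation; $\mathcal{L}$ is injective). Powers of complex numbers are taken with the principal branch. A function $f:(0,\infty)\to[0,\infty)$ is called a generalized Stieltjes function of order $\beta>0$ if $$f(x)=\frac{c_0}{x^\beta}+c_1+\int_{(0,\infty)}\frac{\nu(ds)}{(x+s)^\beta},\qquad x>0,$$ with constants $c_0,c_1\ge 0$ and a positive Radon measure $\nu$ on $(0,\infty)$ such that $\int_{(0,\infty)}(1+s)^{-\beta}\,\nu(ds)<\infty$. Such an $f$ has a unique analytic extension to $\mathbb{C}\setminus(-\infty,0]$, which is denoted by the same symbol. **Theorem 4.2 (with Corollary 4.3).** Let $\beta>0$. Then the function $z\mapsto\left(\frac{z}{z+1}\right)^\beta$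 belongs to $A^1_+$; let $c_\beta$ be its norm. Let $F\in A^1_+$ be such that $z^{-\beta}F\in A^1_+$, and put $a=\|F\|$, $b=\|z^{-\beta}F\|$. 1. For every generalized Stieltjes function $f$ of order $\beta$, the product $Ff$ belongs to $A^1_+$ and $$\|Ff\|\le 2^\beta\, a\, f\!\left((a/b)^{1/\beta}\,c_\beta^{-1/\beta}\right),$$ where the right-hand side is read as $0$ if $F=0$. 2. For every $\alpha\in[0,\beta]$, the function $z^{-\alpha}F$ belongs to $A^1_+$ and $$\|z^{-\alpha}F\|\le 2^\beta\, c_\beta^{\alpha/\beta}\, a^{1-\alpha/\beta}\, b^{\alpha/\beta}$$ (with $0^0=1$). -/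

import Mathlib

noncomputable section

namespace LaplaceAlgebra

open MeasureTheory

/-- The Laplace transform `z ↦ ∫_{[0,∞)} e^{-sz} μ(ds)` of a complex Borel measure `μ` on `[0,∞)`.
The pairing is multiplication of complex numbers. -/
def laplace (μ : ComplexMeasure NNReal) (z : ℂ) : ℂ :=
  VectorMeasure.integral μ (fun s : NNReal => Complex.exp (-(((s : ℝ) : ℂ) * z)))
    (ContinuousLinearMap.mul ℝ ℂ)

/-- `F` coincides with the Laplace transform of `μ` on the open right half-plane `ℂ₊`. The values of
`F` outside `ℂ₊` play no role. -/
def Represents (μ : ComplexMeasure NNReal) (F : ℂ → ℂ) : Prop :=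
  ∀ z : ℂ, 0 < z.re → F z = laplace μ z

/-- Membership in the algebra `A¹₊(ℂ₊)` of Laplace transforms of bounded complex (Radon) measures
on `[0,∞)`. A complex measure automatically has finite total variation. -/
def MemA (F : ℂ → ℂ) : Prop :=
  ∃ μ : ComplexMeasure NNReal, Represents μ F

/-- The norm of `A¹₊(ℂ₊)`: the total variation `|μ|([0,∞))` of the measure `μ` whose Laplace
transform is `F`. As the Laplace transform is injective, for `F` in the algebra the set below has
exactly one element. -/
def normA (F : ℂ → ℂ) : ℝ :=
  sInf {r : ℝ | ∃ μ : ComplexMeasure NNReal,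
    Represents μ F ∧ r = (VectorMeasure.variation μ Set.univ).toReal}

/-- The function `z ↦ (z / (z + 1)) ^ β` (principal branch). -/
def u (β : ℝ) (z : ℂ) : ℂ := (z / (z + 1)) ^ (β : ℂ)

/-- The constant `c_β`, the norm of `(z / (z + 1)) ^ β`. -/
def c (β : ℝ) : ℝ := normA (u β)

/-- `f : (0,∞) → [0,∞)` is a generalized Stieltjes function of order `β`:
`f(x) = c₀ / x^β + c₁ + ∫_{(0,∞)} ν(ds) / (x+s)^β` for `x > 0`, with `c₀, c₁ ≥ 0` and a positive
measure `ν` on `(0,∞)` for which `(1+s)^{-β}` is integrable (which makes `ν` finite on bounded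
sets, hence Radon). Only the values of `f` at positive reals and only the restriction of `ν` to
`(0,∞)` matter. -/
def IsGenStieltjes (β : ℝ) (f : ℝ → ℝ) : Prop :=
  ∃ (c₀ c₁ : ℝ) (ν : Measure ℝ), 0 ≤ c₀ ∧ 0 ≤ c₁ ∧
    IntegrableOn (fun s : ℝ => 1 / (1 + s) ^ β) (Set.Ioi 0) ν ∧
    ∀ x : ℝ, 0 < x → f x = c₀ / x ^ β + c₁ + ∫ s in Set.Ioi (0 : ℝ), 1 / (x + s) ^ β ∂ν

/-- `g` is the (unique) analytic extension of `f : (0,∞) → ℝ` to `ℂ \ (-∞,0]`. -/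
def IsAnalyticExtension (f : ℝ → ℝ) (g : ℂ → ℂ) : Prop :=
  DifferentiableOn ℂ g Complex.slitPlane ∧ ∀ x : ℝ, 0 < x → g (x : ℂ) = (f x : ℂ)

end LaplaceAlgebra

end

/-!
Write `A` for the algebra of Laplace transforms of complex measures on `[0,∞)`. The kernel
`F(z) (z + s) ^ (-β)` can be placed in `A` in two ways:

* as the product of `F` with `s ^ (-β) (1 + z / s) ^ (-β)`, a multiple of a dilation of the Laplace
  transform of a Gamma distribution, at the cost `a s ^ (-β)`;
* as the product of `z ^ (-β) F` with `(z / (z + s)) ^ β = u β (z / s)`, a dilation of `u β`, at the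
  cost `b c`, where `c` is the norm of `u β`.

With `x ^ β = a / (b c)` the smaller of the two costs is `a / max (s, x) ^ β`, which is at most
`2 ^ β a / (x + s) ^ β`. Integrating against the Stieltjes measure `ν` gives `2 ^ β a f(x)`. In the
proof the domain of integration is split at `x`, the second form is used below `x` and the first one
above it (`laplaceBound_mul_stieltjesExt`, `split_bound_le`). No injectivity of the Laplace
transform is needed: the norm is an infimum over representing measures, each piece is estimated for
near-optimal measures, and then one passes to the limit.

That the pieces lie in `A` follows from one principle, `laplaceBound_of_integral`: an integral
`∫ exp (-S z) h dP` over any measure space, with `S ≥ 0` and `h` integrable, is the Laplace transform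
of the image of `h · P` under `S`, of total variation at most `∫ |h| dP`. Conversely every complex
measure has a density with respect to a finite positive measure, so that products, sums of series
and mixtures of dilations reduce to Fubini's theorem. Membership of `u β` in `A` comes from the
binomial series of `(1 - 1 / (z + 1)) ^ β`, whose coefficients are absolutely summable for `β > 0`
(`summable_norm_choose`).

The interpolation inequality is the special case `f(x) = x ^ (-α)`, a generalized Stieltjes function
with a density proportional to `s ^ (β - α - 1)`, except at the end points `α = 0` and `α = β`, where
it is immediate from `1 ≤ c`.
-/

namespace LaplaceAlgebra

open MeasureTheory Filter Topology Set
open scoped NNReal ENNReal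

/-! ### Complex measures as densities -/

/-- Radon–Nikodym: a complex measure has an integrable density with respect to the sum of the total
variations of its real and imaginary parts. -/
lemma exists_eq_withDensityᵥ {X : Type*} [MeasurableSpace X] (μ : ComplexMeasure X) :
    ∃ (P : Measure X) (h : X → ℂ), IsFiniteMeasure P ∧ Integrable h P ∧
      μ = P.withDensityᵥ h := by
  let P : Measure X := (ComplexMeasure.re μ).totalVariation + (ComplexMeasure.im μ).totalVariation
  have hre : P.withDensityᵥ ((ComplexMeasure.re μ).rnDeriv P) = ComplexMeasure.re μ := by
    apply SignedMeasure.withDensityᵥ_rnDeriv_eq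
    rw [SignedMeasure.absolutelyContinuous_ennreal_iff,
      show P.toENNRealVectorMeasure.ennrealToMeasure = P from
        VectorMeasure.equivMeasure.right_inv P]
    exact Measure.AbsolutelyContinuous.rfl.add_right _
  have him : P.withDensityᵥ ((ComplexMeasure.im μ).rnDeriv P) = ComplexMeasure.im μ := by
    apply SignedMeasure.withDensityᵥ_rnDeriv_eq
    rw [SignedMeasure.absolutelyContinuous_ennreal_iff,
      show P.toENNRealVectorMeasure.ennrealToMeasure = P from
        VectorMeasure.equivMeasure.right_inv P]
    change _ ≪ _ + _
    rw [add_comm]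
    exact Measure.AbsolutelyContinuous.rfl.add_right _
  have hint := μ.integrable_rnDeriv P
  refine ⟨P, μ.rnDeriv P, inferInstance, hint, ?_⟩
  ext i hi
  rw [withDensityᵥ_apply hint hi]
  apply Complex.ext
  · rw [← RCLike.re_eq_complex_re, ← integral_re hint.integrableOn]
    have := congrArg (fun s : SignedMeasure X => s i) hre
    simp only [withDensityᵥ_apply (SignedMeasure.integrable_rnDeriv _ _) hi] at this
    exact this.symm
  · rw [← RCLike.im_eq_complex_im, ← integral_im hint.integrableOn]
    have := congrArg (fun s : SignedMeasure X => s i) him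
    simp only [withDensityᵥ_apply (SignedMeasure.integrable_rnDeriv _ _) hi] at this
    exact this.symm

lemma variation_withDensityᵥ_univ {X : Type*} [MeasurableSpace X] {P : Measure X} {h : X → ℂ}
    (hh : Integrable h P) :
    ((P.withDensityᵥ h).variation univ) = ENNReal.ofReal (∫ x, ‖h x‖ ∂P) := by
  rw [Measure.variation_withDensityᵥ hh, withDensity_apply _ MeasurableSet.univ, setLIntegral_univ,
    ofReal_integral_norm_eq_lintegral_enorm hh]

lemma isFiniteMeasure_variation_withDensityᵥ {X : Type*} [MeasurableSpace X] {P : Measure X}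
    {h : X → ℂ} (hh : Integrable h P) : IsFiniteMeasure (P.withDensityᵥ h).variation :=
  ⟨by rw [variation_withDensityᵥ_univ hh]; exact ENNReal.ofReal_lt_top⟩

/-- Integrating a bounded function against the complex measure `h · P` amounts to integrating its
product with `h` against `P`. -/
lemma integral_withDensityᵥ {X : Type*} [MeasurableSpace X] {P : Measure X} {h : X → ℂ}
    (hh : Integrable h P) {f : X → ℂ} (hf : StronglyMeasurable f) {C : ℝ} (hC : ∀ x, ‖f x‖ ≤ C) :
    VectorMeasure.integral (P.withDensityᵥ h) f (ContinuousLinearMap.mul ℝ ℂ) =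
      ∫ x, f x * h x ∂P := by
  have := isFiniteMeasure_variation_withDensityᵥ hh
  have hbdd : ∀ g : SimpleFunc X ℂ, ∃ C, ∀ x, ‖g x‖ ≤ C := fun g => g.exists_forall_norm_le
  have hint : ∀ g : SimpleFunc X ℂ, (P.withDensityᵥ h).Integrable g := fun g => by
    obtain ⟨C, hC⟩ := hbdd g
    exact Integrable.of_bound g.stronglyMeasurable.aestronglyMeasurable C (Eventually.of_forall hC)
  have hint' : ∀ g : SimpleFunc X ℂ, Integrable (fun x => g x * h x) P := fun g => by
    obtain ⟨C, hC⟩ := hbdd g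
    exact hh.bdd_mul g.stronglyMeasurable.aestronglyMeasurable (Eventually.of_forall hC)
  have hsimple : ∀ g : SimpleFunc X ℂ,
      VectorMeasure.integral (P.withDensityᵥ h) g (ContinuousLinearMap.mul ℝ ℂ) =
        ∫ x, g x * h x ∂P := by
    intro g
    induction g using SimpleFunc.induction with
    | const c hs =>
      rename_i s
      have e : ((SimpleFunc.piecewise s hs (SimpleFunc.const X c) (SimpleFunc.const X 0) :
          SimpleFunc X ℂ) : X → ℂ) = s.indicator (fun _ => c) := by
        ext x; by_cases hx : x ∈ s <;> simp [hx]
      rw [e, VectorMeasure.integral_eq_setToFun,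
        setToFun_indicator_const _ hs (measure_ne_top _ _)]
      have e2 : (fun x => s.indicator (fun _ => c) x * h x) = s.indicator (fun x => c * h x) := by
        ext x; by_cases hx : x ∈ s <;> simp [hx]
      rw [e2, integral_indicator hs, integral_const_mul, ← withDensityᵥ_apply hh hs]
      rfl
    | add hd hf hg =>
      rename_i f g
      rw [SimpleFunc.coe_add, VectorMeasure.integral_add (hint f) (hint g), hf, hg,
        ← integral_add (hint' f) (hint' g)]
      simp [add_mul]
  have hC0 : ∀ x : X, 0 ≤ C := fun x => (norm_nonneg _).trans (hC x)
  rcases isEmpty_or_nonempty X with hX | ⟨⟨x₀⟩⟩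
  · rw [integral_of_isEmpty, VectorMeasure.integral_of_isEmpty]
  have h0 := hC0 x₀
  have t1 : Tendsto (fun n => VectorMeasure.integral (P.withDensityᵥ h) (hf.approxBounded C n)
      (ContinuousLinearMap.mul ℝ ℂ)) atTop
      (𝓝 (VectorMeasure.integral (P.withDensityᵥ h) f (ContinuousLinearMap.mul ℝ ℂ))) :=
    VectorMeasure.tendsto_integral_of_dominated_convergence (fun _ => C)
      (fun n => (hf.approxBounded C n).stronglyMeasurable.aestronglyMeasurable)
      (integrable_const _)
      (fun n => Eventually.of_forall (hf.norm_approxBounded_le h0 n))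
      (Eventually.of_forall fun x => hf.tendsto_approxBounded_of_norm_le (hC x))
  have t2 : Tendsto (fun n => ∫ x, hf.approxBounded C n x * h x ∂P) atTop
      (𝓝 (∫ x, f x * h x ∂P)) := by
    refine tendsto_integral_of_dominated_convergence (fun x => C * ‖h x‖)
      (fun n => (hint' _).aestronglyMeasurable) (hh.norm.const_mul C)
      (fun n => Eventually.of_forall fun x => ?_)
      (Eventually.of_forall fun x => (hf.tendsto_approxBounded_of_norm_le (hC x)).mul_const _)
    rw [norm_mul]
    exact mul_le_mul_of_nonneg_right (hf.norm_approxBounded_le h0 n x) (norm_nonneg _)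
  simp only [hsimple] at t1
  exact tendsto_nhds_unique t1 t2

lemma norm_exp_neg_mul_le_one (s : ℝ≥0) {z : ℂ} (hz : 0 < z.re) :
    ‖Complex.exp (-(((s : ℝ) : ℂ) * z))‖ ≤ 1 := by
  rw [Complex.norm_exp, Real.exp_le_one_iff]
  simp only [Complex.neg_re, Complex.mul_re, Complex.ofReal_re, Complex.ofReal_im, zero_mul,
    sub_zero]
  have := mul_nonneg s.coe_nonneg hz.le
  linarith

lemma measurable_exp_neg_mul (z : ℂ) :
    Measurable (fun s : ℝ≥0 => Complex.exp (-(((s : ℝ) : ℂ) * z))) := by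
  fun_prop

/-! ### Bounds for Laplace transforms -/

/-- `F` is on `ℂ₊` the Laplace transform of a complex measure of total variation at most `r`. -/
def LaplaceBound (F : ℂ → ℂ) (r : ℝ) : Prop :=
  ∃ μ : ComplexMeasure ℝ≥0, Represents μ F ∧ (μ.variation univ).toReal ≤ r

/-- A superposition `∫ e^{-S z} h dP` over an arbitrary measure space is a Laplace transform: the
representing measure is the image under `S` of the complex measure `h · P`. -/
lemma laplaceBound_of_integral {Ω : Type*} [MeasurableSpace Ω] {P : Measure Ω} {S : Ω → ℝ≥0}
    (hS : Measurable S) {h : Ω → ℂ} (hh : Integrable h P) {r : ℝ} (hr : ∫ w, ‖h w‖ ∂P ≤ r)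
    {F : ℂ → ℂ} (hF : ∀ z : ℂ, 0 < z.re →
      F z = ∫ w, Complex.exp (-(((S w : ℝ) : ℂ) * z)) * h w ∂P) :
    LaplaceBound F r := by
  have := isFiniteMeasure_variation_withDensityᵥ hh
  refine ⟨(P.withDensityᵥ h).map S, fun z hz => ?_, ?_⟩
  · rw [hF z hz, laplace, VectorMeasure.integral_map hS
      (measurable_exp_neg_mul z).aestronglyMeasurable,
      integral_withDensityᵥ hh (f := fun w => Complex.exp (-(((S w : ℝ) : ℂ) * z)))
        ((measurable_exp_neg_mul z).comp hS).stronglyMeasurable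
        (C := 1) (fun w => norm_exp_neg_mul_le_one _ hz)]
    · exact Integrable.of_bound ((measurable_exp_neg_mul z).comp hS).aestronglyMeasurable 1
        (Eventually.of_forall fun w => norm_exp_neg_mul_le_one _ hz)
  · refine le_trans ?_ hr
    have h1 : ((P.withDensityᵥ h).map S).variation univ ≤ (P.withDensityᵥ h).variation univ := by
      refine (VectorMeasure.variation_map_le univ).trans_eq ?_
      rw [Measure.map_apply hS MeasurableSet.univ, preimage_univ]
    rw [variation_withDensityᵥ_univ hh] at h1
    exact ENNReal.toReal_le_of_le_ofReal (integral_nonneg fun _ => norm_nonneg _) h1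

/-- Every Laplace transform is a superposition of exponentials against a finite positive measure, with
an integrable density whose `L¹` norm is the total variation. -/
lemma LaplaceBound.exists_integral {F : ℂ → ℂ} {r : ℝ} (hF : LaplaceBound F r) :
    ∃ (P : Measure ℝ≥0) (h : ℝ≥0 → ℂ), IsFiniteMeasure P ∧ Integrable h P ∧ ∫ s, ‖h s‖ ∂P ≤ r ∧
      ∀ z : ℂ, 0 < z.re → F z = ∫ s : ℝ≥0, Complex.exp (-(((s : ℝ) : ℂ) * z)) * h s ∂P := by
  obtain ⟨μ, hμ, hr⟩ := hF
  obtain ⟨P, h, hP, hh, rfl⟩ := exists_eq_withDensityᵥ μ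
  refine ⟨P, h, hP, hh, ?_, fun z hz => ?_⟩
  · rwa [variation_withDensityᵥ_univ hh,
      ENNReal.toReal_ofReal (integral_nonneg fun _ => norm_nonneg _)] at hr
  · rw [hμ z hz, laplace, integral_withDensityᵥ hh (measurable_exp_neg_mul z).stronglyMeasurable
      (C := 1) (fun w => norm_exp_neg_mul_le_one _ hz)]

lemma LaplaceBound.congr {F G : ℂ → ℂ} {r : ℝ} (hF : LaplaceBound F r)
    (h : ∀ z : ℂ, 0 < z.re → G z = F z) : LaplaceBound G r := by
  obtain ⟨μ, hμ, hr⟩ := hF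
  exact ⟨μ, fun z hz => (h z hz).trans (hμ z hz), hr⟩

lemma LaplaceBound.mono {F : ℂ → ℂ} {r r' : ℝ} (hF : LaplaceBound F r) (h : r ≤ r') :
    LaplaceBound F r' := by
  obtain ⟨μ, hμ, hr⟩ := hF
  exact ⟨μ, hμ, hr.trans h⟩

lemma LaplaceBound.norm_le {F : ℂ → ℂ} {r : ℝ} (hF : LaplaceBound F r) {z : ℂ} (hz : 0 < z.re) :
    ‖F z‖ ≤ r := by
  obtain ⟨P, h, -, hh, hr, hF⟩ := hF.exists_integral
  rw [hF z hz]
  refine (norm_integral_le_of_norm_le hh.norm (Eventually.of_forall fun s => ?_)).trans hr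
  rw [norm_mul]
  exact mul_le_of_le_one_left (norm_nonneg _) (norm_exp_neg_mul_le_one s hz)

lemma LaplaceBound.nonneg {F : ℂ → ℂ} {r : ℝ} (hF : LaplaceBound F r) : 0 ≤ r :=
  (norm_nonneg _).trans (hF.norm_le (z := 1) (by simp))

lemma LaplaceBound.memA {F : ℂ → ℂ} {r : ℝ} (hF : LaplaceBound F r) : MemA F :=
  let ⟨μ, hμ, _⟩ := hF; ⟨μ, hμ⟩

lemma normA_nonneg (F : ℂ → ℂ) : 0 ≤ normA F := by
  apply Real.sInf_nonneg
  rintro _ ⟨μ, -, rfl⟩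
  exact ENNReal.toReal_nonneg

lemma LaplaceBound.normA_le {F : ℂ → ℂ} {r : ℝ} (hF : LaplaceBound F r) : normA F ≤ r := by
  obtain ⟨μ, hμ, hr⟩ := hF
  have hmem : (μ.variation univ).toReal ∈ {r : ℝ | ∃ μ : ComplexMeasure ℝ≥0,
      Represents μ F ∧ r = (μ.variation univ).toReal} := ⟨μ, hμ, rfl⟩
  refine (csInf_le ⟨0, ?_⟩ hmem).trans hr
  rintro _ ⟨μ, -, rfl⟩
  exact ENNReal.toReal_nonneg

/-- The norm is an infimum; whether it is attained is left open here, hence the strict inequality. -/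
lemma MemA.laplaceBound {F : ℂ → ℂ} (hF : MemA F) {r : ℝ} (hr : normA F < r) :
    LaplaceBound F r := by
  obtain ⟨μ, hμ⟩ := hF
  obtain ⟨_, ⟨μ', hμ', rfl⟩, h⟩ := exists_lt_of_csInf_lt
    (s := {r : ℝ | ∃ μ : ComplexMeasure ℝ≥0, Represents μ F ∧ r = (μ.variation univ).toReal})
    ⟨_, μ, hμ, rfl⟩ hr
  exact ⟨μ', hμ', h.le⟩

lemma MemA.norm_le {F : ℂ → ℂ} (hF : MemA F) {z : ℂ} (hz : 0 < z.re) : ‖F z‖ ≤ normA F :=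
  le_of_forall_gt_imp_ge_of_dense fun _ hr => (hF.laplaceBound hr).norm_le hz

lemma laplaceBound_const (c : ℂ) : LaplaceBound (fun _ => c) ‖c‖ :=
  laplaceBound_of_integral (P := Measure.dirac ()) (S := fun _ => 0) measurable_const
    (h := fun _ => c) (integrable_const c) (by simp) (by simp)

/-- The product of two Laplace transforms is the Laplace transform of the convolution. -/
lemma LaplaceBound.mul {F G : ℂ → ℂ} {r r' : ℝ} (hF : LaplaceBound F r) (hG : LaplaceBound G r') :
    LaplaceBound (fun z => F z * G z) (r * r') := by
  have hr0 := hF.nonneg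
  obtain ⟨P, h, hP, hh, hr, hF⟩ := hF.exists_integral
  obtain ⟨Q, k, hQ, hk, hr', hG⟩ := hG.exists_integral
  refine laplaceBound_of_integral (P := P.prod Q) (S := fun w => w.1 + w.2) (by fun_prop)
    (h := fun w => h w.1 * k w.2) (hh.mul_prod hk) ?_ fun z hz => ?_
  · simp only [norm_mul]
    rw [integral_prod_mul (fun x => ‖h x‖) (fun y => ‖k y‖)]
    exact mul_le_mul hr hr' (integral_nonneg fun _ => norm_nonneg _) hr0
  · rw [hF z hz, hG z hz, ← integral_prod_mul]
    refine integral_congr_ae (Eventually.of_forall fun w => ?_)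
    simp only [NNReal.coe_add, Complex.ofReal_add, add_mul, neg_add, Complex.exp_add]
    ring

lemma LaplaceBound.pow {F : ℂ → ℂ} {r : ℝ} (hF : LaplaceBound F r) (n : ℕ) :
    LaplaceBound (fun z => F z ^ n) (r ^ n) := by
  induction n with
  | zero => simpa using laplaceBound_const 1
  | succ n ih => simpa only [pow_succ] using ih.mul hF

/-- Absolutely convergent series of Laplace transforms: the representing densities are glued on
`[0,∞) × ι`. -/
lemma LaplaceBound.hasSum {ι : Type*} [Countable ι] [MeasurableSpace ι]
    [MeasurableSingletonClass ι] {F : ι → ℂ → ℂ} {r : ι → ℝ} (hF : ∀ i, LaplaceBound (F i) (r i))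
    (hr : Summable r) {G : ℂ → ℂ} (hG : ∀ z : ℂ, 0 < z.re → HasSum (fun i => F i z) (G z)) :
    LaplaceBound G (∑' i, r i) := by
  choose P h hP hh hhr hFz using fun i => (hF i).exists_integral
  have hι : ∀ i : ι, MeasurableEmbedding (fun s : ℝ≥0 => (s, i)) := fun i =>
    measurableEmbedding_prod_mk_right i
  have hint : ∀ i, Integrable (fun w : ℝ≥0 × ι => h w.2 w.1) ((P i).map fun s => (s, i)) :=
    fun i => by
      rw [(hι i).integrable_map_iff]
      exact hh i
  have hnorm : ∀ i, ∫ w : ℝ≥0 × ι, ‖h w.2 w.1‖ ∂((P i).map fun s => (s, i)) = ∫ s, ‖h i s‖ ∂P i :=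
    fun i => (hι i).integral_map _
  have hsum : Summable fun i => ∫ s, ‖h i s‖ ∂P i :=
    Summable.of_nonneg_of_le (fun i => integral_nonneg fun _ => norm_nonneg _) hhr hr
  have hI : Integrable (fun w : ℝ≥0 × ι => h w.2 w.1)
      (Measure.sum fun i => (P i).map fun s => (s, i)) := by
    refine integrable_sum_measure hint ?_
    simpa only [hnorm] using hsum
  refine laplaceBound_of_integral (S := fun w : ℝ≥0 × ι => w.1) measurable_fst hI ?_
    fun z hz => ?_
  · have h1 := hasSum_integral_measure hI.norm
    simp only [hnorm] at h1
    rw [← h1.tsum_eq]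
    exact hsum.tsum_le_tsum hhr hr
  · have hI' : Integrable (fun w : ℝ≥0 × ι => Complex.exp (-(((w.1 : ℝ) : ℂ) * z)) * h w.2 w.1)
        (Measure.sum fun i => (P i).map fun s => (s, i)) :=
      hI.bdd_mul ((measurable_exp_neg_mul z).comp measurable_fst).aestronglyMeasurable
        (c := 1) (Eventually.of_forall fun w => norm_exp_neg_mul_le_one _ hz)
    have h1 := hasSum_integral_measure hI'
    have h2 : ∀ i, ∫ w : ℝ≥0 × ι, Complex.exp (-(((w.1 : ℝ) : ℂ) * z)) * h w.2 w.1
        ∂((P i).map fun s => (s, i)) = F i z := fun i => by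
      rw [(hι i).integral_map, hFz i z hz]
    simp only [h2] at h1
    exact (hG z hz).unique h1

lemma LaplaceBound.add {F G : ℂ → ℂ} {r r' : ℝ} (hF : LaplaceBound F r) (hG : LaplaceBound G r') :
    LaplaceBound (fun z => F z + G z) (r + r') := by
  have := LaplaceBound.hasSum (F := fun b : Bool => bif b then F else G)
    (r := fun b => bif b then r else r') (by rintro (_ | _) <;> assumption)
    (Summable.of_finite) (G := fun z => F z + G z) fun z _ => by
      simpa [Fintype.sum_bool] using hasSum_fintype (fun b : Bool => (bif b then F else G) z)
  simpa [tsum_fintype, Fintype.sum_bool] using this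

/-! ### Complex powers and the identity theorem -/

/-- The principal powers of a quotient split as long as numerator and denominator lie in `ℂ₊`: the
difference of their arguments stays in `(-π, π)`. -/
lemma div_cpow_of_re_pos {w v : ℂ} (hw : 0 < w.re) (hv : 0 < v.re) (γ : ℂ) :
    (w / v) ^ γ = w ^ γ * v ^ (-γ) := by
  have hw0 : w ≠ 0 := fun h => by simp [h] at hw
  have hv0 : v ≠ 0 := fun h => by simp [h] at hv
  have h1 := Complex.abs_arg_lt_pi_div_two_iff.2 (Or.inl hw)
  have h2 := Complex.abs_arg_lt_pi_div_two_iff.2 (Or.inl hv)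
  rw [abs_lt] at h1 h2
  have hne : v.arg ≠ Real.pi := by linarith [Real.pi_pos]
  have hlog : Complex.log (w / v) = Complex.log w - Complex.log v := by
    rw [div_eq_mul_inv, Complex.log_mul hw0 (inv_ne_zero hv0), Complex.log_inv _ hne, sub_eq_add_neg]
    rw [Complex.arg_inv, if_neg hne]
    constructor <;> linarith
  rw [Complex.cpow_def_of_ne_zero (div_ne_zero hw0 hv0), Complex.cpow_def_of_ne_zero hw0,
    Complex.cpow_def_of_ne_zero hv0, hlog, ← Complex.exp_add]
  ring_nf

lemma frequently_ofReal_pos : ∃ᶠ z : ℂ in 𝓝[≠] 1, ∃ x : ℝ, 0 < x ∧ z = x := by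
  have ht : Tendsto (fun x : ℝ => (x : ℂ)) (𝓝[≠] 1) (𝓝[≠] 1) := by
    refine tendsto_nhdsWithin_iff.2 ⟨?_, ?_⟩
    · exact (Complex.continuous_ofReal.tendsto' 1 1 (by simp)).mono_left nhdsWithin_le_nhds
    · filter_upwards [self_mem_nhdsWithin] with x hx
      simpa using hx
  refine ht.frequently (Eventually.frequently ?_)
  filter_upwards [nhdsWithin_le_nhds (lt_mem_nhds one_pos)] with x hx
  exact ⟨x, hx, rfl⟩

lemma eqOn_of_eq_ofReal_pos {U : Set ℂ} (hUo : IsOpen U) (hU : IsPreconnected U) (h1 : 1 ∈ U)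
    {f g : ℂ → ℂ} (hf : DifferentiableOn ℂ f U) (hg : DifferentiableOn ℂ g U)
    (h : ∀ x : ℝ, 0 < x → f x = g x) : EqOn f g U := by
  refine (hf.analyticOnNhd hUo).eqOn_of_preconnected_of_frequently_eq (hg.analyticOnNhd hUo) hU h1
    (frequently_ofReal_pos.mono ?_)
  rintro _ ⟨x, hx, rfl⟩
  exact h x hx

/-! ### The functions `(1 + z) ^ (-β)` and `(z / (z + 1)) ^ β` -/

/-- `(1 + z) ^ (-β)` is the Laplace transform of the Gamma distribution of shape `β` and rate `1`. -/
lemma laplaceBound_one_add_cpow_neg {β : ℝ} (hβ : 0 < β) :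
    LaplaceBound (fun z => (1 + z) ^ (-(β : ℂ))) 1 := by
  let d : ℝ → ℝ := fun t => (Real.Gamma β)⁻¹ * (t ^ (β - 1) * Real.exp (-t))
  let P : Measure ℝ := (volume.restrict (Ioi 0)).withDensity fun t => ENNReal.ofReal (d t)
  have hΓ := Real.Gamma_pos_of_pos hβ
  have hd : ∀ t ∈ Ioi (0 : ℝ), 0 ≤ d t := fun t ht => by
    have : 0 < t := ht
    positivity
  have hdm : Measurable d := by fun_prop
  have hdint : IntegrableOn d (Ioi 0) := by
    refine Integrable.const_mul (IntegrableOn.integrable ?_) _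
    simpa only [mul_comm] using Real.GammaIntegral_convergent hβ
  -- integrals against `P` in terms of the density
  have hP : ∀ f : ℝ → ℝ, ∫ t, f t ∂P = ∫ t in Ioi 0, d t * f t := fun f => by
    rw [integral_withDensity_eq_integral_toReal_smul hdm.ennreal_ofReal
      (Eventually.of_forall fun _ => ENNReal.ofReal_lt_top)]
    refine setIntegral_congr_fun measurableSet_Ioi fun t ht => ?_
    simp only [ENNReal.toReal_ofReal (hd t ht), smul_eq_mul]
  have hPfin : IsFiniteMeasure P := by
    refine isFiniteMeasure_withDensity_ofReal hdint.2
  have hpos : ∀ᵐ t ∂P, 0 < t :=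
    (withDensity_absolutelyContinuous _ _).ae_le (ae_restrict_mem measurableSet_Ioi)
  have hmgf : ∀ x : ℝ, 0 ≤ x → ∫ t, Real.exp (-x * t) ∂P = (1 + x) ^ (-β) := fun x hx => by
    rw [hP, Real.rpow_neg (by positivity), ← Real.inv_rpow (by positivity), ← one_div]
    have h := Real.integral_rpow_mul_exp_neg_mul_Ioi hβ (r := 1 + x) (by positivity)
    rw [← div_left_inj' hΓ.ne', mul_div_cancel_right₀ _ hΓ.ne'] at h
    rw [← h, div_eq_inv_mul, ← integral_const_mul]
    refine integral_congr_ae (Eventually.of_forall fun t => ?_)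
    simp only [d]
    rw [mul_assoc, mul_assoc, ← Real.exp_add]
    ring_nf
  have hset : ∀ y : ℝ, y ≤ 0 → y ∈ ProbabilityTheory.integrableExpSet id P := fun y hy => by
    refine Integrable.of_bound (by fun_prop) 1 ?_
    filter_upwards [hpos] with t ht
    rw [Real.norm_eq_abs, Real.abs_exp, Real.exp_le_one_iff]
    exact mul_nonpos_of_nonpos_of_nonneg hy ht.le
  have hmem : ∀ z : ℂ, 0 < z.re →
      (-z).re ∈ interior (ProbabilityTheory.integrableExpSet id P) := fun z hz =>
    interior_maximal (fun y (hy : y ∈ Iio 0) => hset y (le_of_lt hy)) isOpen_Iio (by simpa using hz)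
  have hU : IsOpen {z : ℂ | 0 < z.re} := isOpen_lt continuous_const Complex.continuous_re
  have heq : EqOn (fun z => ProbabilityTheory.complexMGF id P (-z))
      (fun z => (1 + z) ^ (-(β : ℂ))) {z : ℂ | 0 < z.re} := by
    refine eqOn_of_eq_ofReal_pos hU (convex_halfSpace_re_gt 0).isPreconnected (by simp)
      (fun z hz => ?_) (fun z hz => ?_) fun x hx => ?_
    · have := (ProbabilityTheory.hasDerivAt_complexMGF (hmem z hz)).differentiableAt
      exact (this.comp z differentiableAt_id.neg).differentiableWithinAt
    · have hz' : 0 < z.re := hz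
      refine DifferentiableAt.differentiableWithinAt ?_
      refine DifferentiableAt.cpow (by fun_prop) (by fun_prop) (Or.inl ?_)
      simp only [Complex.add_re, Complex.one_re]
      linarith
    · rw [← Complex.ofReal_neg, ProbabilityTheory.complexMGF_ofReal, ProbabilityTheory.mgf]
      simp only [id]
      rw [hmgf x hx.le, Complex.ofReal_cpow (by positivity)]
      simp
  refine laplaceBound_of_integral (P := P) (S := Real.toNNReal) measurable_real_toNNReal
    (h := fun _ => 1) (integrable_const 1) ?_ fun z hz => ?_
  · have := hmgf 0 le_rfl
    simp at this
    simp [this]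
  · rw [← show ProbabilityTheory.complexMGF id P (-z) = (1 + z) ^ (-(β : ℂ)) from heq hz,
      ProbabilityTheory.complexMGF]
    refine integral_congr_ae ?_
    filter_upwards [hpos] with t ht
    rw [mul_one, Real.coe_toNNReal _ ht.le]
    simp only [id]
    ring_nf

lemma succ_mul_choose_succ (β : ℝ) (k : ℕ) :
    ((k : ℝ) + 1) * Ring.choose β (k + 1) = (β - k) * Ring.choose β k := by
  have := Ring.choose_smul_choose β (Nat.le_succ k)
  rw [Nat.succ_eq_add_one, Nat.choose_succ_self_right, Nat.add_sub_cancel_left,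
    Ring.choose_one_right, nsmul_eq_mul] at this
  push_cast at this
  rw [this, mul_comm]

/-- The binomial series of exponent `β > 0` converges absolutely on the closed unit disc. With
`b k = |choose β k|` one has `β * b k = k * b k - (k + 1) * b (k + 1)` for `k ≥ β`, so that the
partial sums telescope. -/
lemma summable_norm_choose {β : ℝ} (hβ : 0 < β) : Summable fun k : ℕ => ‖Ring.choose β k‖ := by
  let b : ℕ → ℝ := fun k => ‖Ring.choose β k‖
  let N := ⌈β⌉₊
  have hrec : ∀ k : ℕ, β ≤ k → β * b k = k * b k - ((k : ℝ) + 1) * b (k + 1) := fun k hk => by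
    have h := congrArg norm (succ_mul_choose_succ β k)
    rw [norm_mul, norm_mul, Real.norm_of_nonneg (by positivity : (0 : ℝ) ≤ (k : ℝ) + 1),
      Real.norm_of_nonpos (sub_nonpos.2 hk)] at h
    change ((k : ℝ) + 1) * b (k + 1) = -(β - k) * b k at h
    rw [h]; ring
  have hb : ∀ k, 0 ≤ b k := fun k => norm_nonneg _
  have hsum : ∀ n, ∑ k ∈ Finset.range n, β * b (k + N) =
      N * b N - ((n : ℝ) + N) * b (n + N) := fun n => by
    induction n with
    | zero => simp
    | succ n ih =>
      have hle : β ≤ ((n + N : ℕ) : ℝ) :=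
        (Nat.le_ceil β).trans (by exact_mod_cast Nat.le_add_left _ _)
      have := hrec _ hle
      rw [Finset.sum_range_succ, ih, this, show n + 1 + N = n + N + 1 by ring]
      push_cast
      ring
  have hs : Summable fun k => β * b (k + N) := by
    refine summable_of_sum_range_le (c := N * b N) (fun k => mul_nonneg hβ.le (hb _)) fun n => ?_
    rw [hsum n]
    have := mul_nonneg (by positivity : (0 : ℝ) ≤ (n : ℝ) + N) (hb (n + N))
    linarith
  exact (summable_nat_add_iff N).1 ((summable_mul_left_iff hβ.ne').1 hs)

/-- `(z / (z + 1)) ^ β = (1 - 1 / (z + 1)) ^ β` expands into an absolutely convergent binomial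
series of powers of `1 / (z + 1)`, which has norm one in the algebra. -/
lemma memA_u {β : ℝ} (hβ : 0 < β) : MemA (u β) := by
  have hE : LaplaceBound (fun z => (1 + z) ^ (-((1 : ℝ) : ℂ))) 1 :=
    laplaceBound_one_add_cpow_neg one_pos
  refine (LaplaceBound.hasSum
    (F := fun k z => ((Ring.choose β k * (-1) ^ k : ℝ) : ℂ) * ((1 + z) ^ (-((1 : ℝ) : ℂ))) ^ k)
    (r := fun k => ‖((Ring.choose β k * (-1) ^ k : ℝ) : ℂ)‖ * 1 ^ k)
    (fun k => (laplaceBound_const _).mul (hE.pow k)) ?_ fun z hz => ?_).memA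
  · simpa using summable_norm_choose hβ
  · have hz1 : 0 < (1 + z).re := by simp only [Complex.add_re, Complex.one_re]; linarith
    have hz0 : (1 + z) ≠ 0 := fun h => by simp [h] at hz1
    have hnorm : ‖-(1 + z)⁻¹‖ < 1 := by
      rw [norm_neg, norm_inv]
      apply inv_lt_one_of_one_lt₀
      refine lt_of_lt_of_le ?_ (Complex.re_le_norm _)
      simp only [Complex.add_re, Complex.one_re]; linarith
    have h := (Complex.one_add_cpow_hasFPowerSeriesOnBall_zero (a := (β : ℂ))).hasSum
      (y := -(1 + z)⁻¹) (by
        rw [← ENNReal.ofReal_one, Metric.eball_ofReal, mem_ball_zero_iff]; exact hnorm)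
    have e : (1 : ℂ) + (0 + -(1 + z)⁻¹) = z / (z + 1) := by
      rw [add_comm z 1]; field_simp; ring
    rw [e] at h
    change HasSum _ ((z / (z + 1)) ^ (β : ℂ))
    have key : ∀ k : ℕ, (binomialSeries ℂ (β : ℂ) k) (fun _ => -(1 + z)⁻¹) =
        ((Ring.choose β k * (-1) ^ k : ℝ) : ℂ) * ((1 + z) ^ (-((1 : ℝ) : ℂ))) ^ k := fun k => by
      rw [binomialSeries_apply, List.ofFn_const, List.prod_replicate, ← Complex.ofReal_choose,
        Complex.ofReal_one, Complex.cpow_neg_one, neg_pow]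
      push_cast
      rw [smul_eq_mul]
      ring
    simpa only [key] using h

lemma one_le_c {β : ℝ} (hβ : 0 < β) : 1 ≤ c β := by
  have h : Tendsto (fun n : ℕ => ((n : ℝ) / (n + 1)) ^ β) atTop (𝓝 1) := by
    simpa using (tendsto_natCast_div_add_atTop (1 : ℝ)).rpow_const (p := β) (Or.inr hβ.le)
  refine le_of_tendsto h ?_
  filter_upwards [eventually_gt_atTop 0] with n hn
  have hn' : (0 : ℝ) < n := by exact_mod_cast hn
  have := (memA_u hβ).norm_le (z := (n : ℂ)) (by simpa using hn)
  rw [u, Complex.norm_cpow_real] at this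
  rw [norm_div, Complex.norm_natCast, ← Nat.cast_succ, Complex.norm_natCast] at this
  simpa [c] using this

/-! ### Mixtures of dilations -/

/-- A mixture of the dilations `z ↦ K (z / s)`, `s > 0`, of a Laplace transform is a Laplace
transform. -/
lemma LaplaceBound.mixture {K : ℂ → ℂ} {r : ℝ} (hK : LaplaceBound K r) {ν : Measure ℝ} [SFinite ν]
    (hpos : ∀ᵐ s ∂ν, 0 < s) {m : ℝ → ℝ} (hm : Integrable m ν) (hm0 : ∀ᵐ s ∂ν, 0 ≤ m s) :
    LaplaceBound (fun z => ∫ s, (m s : ℂ) * K (z / s) ∂ν) (r * ∫ s, m s ∂ν) := by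
  obtain ⟨P, h, hP, hh, hr, hKz⟩ := hK.exists_integral
  have hI : Integrable (fun w : ℝ≥0 × ℝ => h w.1 * (m w.2 : ℂ)) (P.prod ν) :=
    hh.mul_prod hm.ofReal
  have hS : Measurable fun w : ℝ≥0 × ℝ => w.1 / w.2.toNNReal := by fun_prop
  refine laplaceBound_of_integral (P := P.prod ν) hS hI ?_ fun z hz => ?_
  · simp only [norm_mul, Complex.norm_real]
    rw [integral_prod_mul (fun x => ‖h x‖) (fun y => ‖m y‖)]
    have e : ∫ s, ‖m s‖ ∂ν = ∫ s, m s ∂ν := integral_congr_ae <| by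
      filter_upwards [hm0] with s hs
      exact Real.norm_of_nonneg hs
    rw [e]
    exact mul_le_mul_of_nonneg_right hr (integral_nonneg_of_ae hm0)
  · have hI' : Integrable (fun w : ℝ≥0 × ℝ =>
        Complex.exp (-((((w.1 / w.2.toNNReal : ℝ≥0) : ℝ) : ℂ) * z)) * (h w.1 * (m w.2 : ℂ)))
        (P.prod ν) :=
      hI.bdd_mul ((measurable_exp_neg_mul z).comp hS).aestronglyMeasurable
        (c := 1) (Eventually.of_forall fun w => norm_exp_neg_mul_le_one _ hz)
    rw [integral_prod_symm _ hI']
    refine integral_congr_ae ?_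
    filter_upwards [hpos] with s hs
    have hzs : 0 < (z / s).re := by
      rw [Complex.div_ofReal_re]; positivity
    rw [hKz _ hzs, ← integral_const_mul]
    refine integral_congr_ae (Eventually.of_forall fun t => ?_)
    simp only [NNReal.coe_div, Real.coe_toNNReal _ hs.le, Complex.ofReal_div]
    rw [show ((t : ℝ) : ℂ) / (s : ℂ) * z = ((t : ℝ) : ℂ) * (z / s) by ring]
    ring

/-! ### Analytic extension of generalized Stieltjes functions -/

/-- The formula for the analytic extension to `ℂ \ (-∞,0]` of the generalized Stieltjes function of
order `β` with data `c₀`, `c₁`, `ν`. -/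
noncomputable def stieltjesExt (β c₀ c₁ : ℝ) (ν : Measure ℝ) (z : ℂ) : ℂ :=
  c₀ * z ^ (-(β : ℂ)) + c₁ + ∫ s in Ioi (0 : ℝ), (z + s) ^ (-(β : ℂ)) ∂ν

lemma add_ofReal_mem_slitPlane {z : ℂ} (hz : z ∈ Complex.slitPlane) {s : ℝ} (hs : 0 ≤ s) :
    z + s ∈ Complex.slitPlane := by
  rw [Complex.mem_slitPlane_iff] at hz ⊢
  simp only [Complex.add_re, Complex.ofReal_re, Complex.add_im, Complex.ofReal_im, add_zero]
  exact hz.imp (fun h => by linarith) id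

/-- Locally uniformly in `z` off the negative half-axis, `|z + s|` is comparable to `1 + s`. -/
lemma exists_mul_le_norm_add {z₀ : ℂ} (hz₀ : z₀ ∈ Complex.slitPlane) :
    ∃ δ > 0, ∃ U ∈ 𝓝 z₀, U ⊆ Complex.slitPlane ∧
      ∀ z ∈ U, ∀ s : ℝ, 0 ≤ s → δ * (1 + s) ≤ ‖z + s‖ := by
  obtain ⟨ρ, hρ, hball⟩ := Metric.isOpen_iff.1 Complex.isOpen_slitPlane z₀ hz₀
  set ε := ρ / 2 with hε
  have hε0 : 0 < ε := by positivity
  set R := ‖z₀‖ + ε with hR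
  have hR0 : 0 < R := by positivity
  refine ⟨ε / (1 + R + ε), by positivity, Metric.ball z₀ ε, Metric.ball_mem_nhds _ hε0,
    (Metric.ball_subset_ball (by linarith)).trans hball, fun z hz s hs => ?_⟩
  rw [mem_ball_iff_norm] at hz
  -- the disc of radius `ε` about `z` does not meet the half-axis, so `-s` is not in it
  have h1 : ε ≤ ‖z + s‖ := by
    by_contra! hlt
    have hmem : (-(s : ℂ)) ∈ Metric.ball z₀ ρ := by
      rw [mem_ball_iff_norm]
      calc ‖-(s : ℂ) - z₀‖ = ‖(z - z₀) - (z + s)‖ := by ring_nf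
        _ ≤ ‖z - z₀‖ + ‖z + s‖ := norm_sub_le _ _
        _ < ρ := by linarith
    have := hball hmem
    rw [Complex.mem_slitPlane_iff] at this
    simp only [Complex.neg_re, Complex.ofReal_re, Complex.neg_im, Complex.ofReal_im, neg_zero,
      ne_eq, not_true_eq_false, or_false] at this
    linarith
  have h2 : s - R ≤ ‖z + s‖ := by
    have h3 : ‖z‖ ≤ R := by
      calc ‖z‖ = ‖z₀ + (z - z₀)‖ := by ring_nf
        _ ≤ ‖z₀‖ + ‖z - z₀‖ := norm_add_le _ _
        _ ≤ R := by linarith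
    have h4 : ‖(s : ℂ)‖ ≤ ‖z + s‖ + ‖z‖ := by
      calc ‖(s : ℂ)‖ = ‖(z + s) - z‖ := by ring_nf
        _ ≤ _ := norm_sub_le _ _
    rw [Complex.norm_real, Real.norm_of_nonneg hs] at h4
    linarith
  rw [div_mul_eq_mul_div, div_le_iff₀ (by positivity)]
  nlinarith

section

variable {β : ℝ} {ν : Measure ℝ}

lemma norm_add_cpow_neg_le {γ : ℝ} (hγ : 0 < γ) {z : ℂ} {s δ : ℝ} (hs : 0 ≤ s) (hδ : 0 < δ)
    (h : δ * (1 + s) ≤ ‖z + s‖) :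
    ‖(z + s) ^ (-(γ : ℂ))‖ ≤ δ ^ (-γ) * (1 / (1 + s) ^ γ) := by
  rw [← Complex.ofReal_neg, Complex.norm_cpow_real, one_div, ← Real.rpow_neg (by positivity),
    ← Real.mul_rpow hδ.le (by positivity)]
  exact Real.rpow_le_rpow_of_nonpos (by positivity) h (by linarith)

lemma measurable_add_cpow (z γ : ℂ) : Measurable (fun s : ℝ => (z + s) ^ γ) := by
  fun_prop

lemma integrableOn_add_cpow_neg (hβ : 0 < β)
    (hν : IntegrableOn (fun s : ℝ => 1 / (1 + s) ^ β) (Ioi 0) ν) {z : ℂ}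
    (hz : z ∈ Complex.slitPlane) :
    IntegrableOn (fun s : ℝ => (z + s) ^ (-(β : ℂ))) (Ioi 0) ν := by
  obtain ⟨δ, hδ, U, hU, -, h⟩ := exists_mul_le_norm_add hz
  refine Integrable.mono' (hν.integrable.const_mul (δ ^ (-β)))
    (measurable_add_cpow _ _).aestronglyMeasurable ?_
  filter_upwards [ae_restrict_mem measurableSet_Ioi] with s hs
  exact norm_add_cpow_neg_le hβ (le_of_lt hs) hδ (h z (mem_of_mem_nhds hU) s (le_of_lt hs))

lemma differentiableOn_stieltjesExt (hβ : 0 < β)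
    (hν : IntegrableOn (fun s : ℝ => 1 / (1 + s) ^ β) (Ioi 0) ν) (c₀ c₁ : ℝ) :
    DifferentiableOn ℂ (stieltjesExt β c₀ c₁ ν) Complex.slitPlane := by
  intro z₀ hz₀
  refine DifferentiableAt.differentiableWithinAt ?_
  refine DifferentiableAt.add (DifferentiableAt.add_const _ ?_) ?_
  · exact (differentiableAt_id.cpow (differentiableAt_const _) hz₀).const_mul _
  · obtain ⟨δ, hδ, U, hU, hUs, h⟩ := exists_mul_le_norm_add hz₀
    refine (hasDerivAt_integral_of_dominated_loc_of_deriv_le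
      (F := fun (z : ℂ) (s : ℝ) => (z + s) ^ (-(β : ℂ)))
      (F' := fun z s => -(β : ℂ) * (z + s) ^ (-(β : ℂ) - 1))
      (bound := fun s => β * (δ ^ (-(β + 1)) * (1 / (1 + s) ^ β))) hU
      (Eventually.of_forall fun z => (measurable_add_cpow _ _).aestronglyMeasurable)
      (integrableOn_add_cpow_neg hβ hν hz₀)
      ((measurable_add_cpow _ _).const_mul _).aestronglyMeasurable ?_
      ((hν.integrable.const_mul _).const_mul _) ?_).2.differentiableAt
    · filter_upwards [ae_restrict_mem measurableSet_Ioi] with s hs z hz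
      have hs' : 0 < s := hs
      have h1 := norm_add_cpow_neg_le (γ := β + 1) (by linarith) hs'.le hδ (h z hz s hs'.le)
      have e : -(β : ℂ) - 1 = -((β + 1 : ℝ) : ℂ) := by push_cast; ring
      rw [norm_mul, norm_neg, Complex.norm_real, Real.norm_of_nonneg hβ.le, e]
      refine mul_le_mul_of_nonneg_left (h1.trans ?_) hβ.le
      refine mul_le_mul_of_nonneg_left ?_ (by positivity)
      exact one_div_le_one_div_of_le (by positivity)
        (Real.rpow_le_rpow_of_exponent_le (by linarith) (by linarith))
    · filter_upwards [ae_restrict_mem measurableSet_Ioi] with s hs z hz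
      have hs' : 0 < s := hs
      have := ((hasDerivAt_id z).add_const (s : ℂ)).cpow_const (c := -(β : ℂ))
        (add_ofReal_mem_slitPlane (hUs hz) hs'.le)
      simpa using this

lemma stieltjesExt_ofReal (c₀ c₁ : ℝ) {x : ℝ} (hx : 0 < x) :
    stieltjesExt β c₀ c₁ ν x =
      ((c₀ / x ^ β + c₁ + ∫ s in Ioi (0 : ℝ), 1 / (x + s) ^ β ∂ν : ℝ) : ℂ) := by
  have key : ∀ y : ℝ, 0 < y → (y : ℂ) ^ (-(β : ℂ)) = ((1 / y ^ β : ℝ) : ℂ) := fun y hy => by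
    rw [← Complex.ofReal_neg, ← Complex.ofReal_cpow hy.le, Real.rpow_neg hy.le, one_div]
  have e : ∫ s in Ioi (0 : ℝ), ((x : ℂ) + s) ^ (-(β : ℂ)) ∂ν =
      ((∫ s in Ioi (0 : ℝ), 1 / (x + s) ^ β ∂ν : ℝ) : ℂ) := by
    rw [← integral_complex_ofReal]
    refine setIntegral_congr_fun measurableSet_Ioi fun s hs => ?_
    have hs' : 0 < s := hs
    change ((x : ℂ) + s) ^ (-(β : ℂ)) = ((1 / (x + s) ^ β : ℝ) : ℂ)
    rw [← Complex.ofReal_add, key _ (by positivity)]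
  rw [stieltjesExt, e, key x hx]
  push_cast
  ring

lemma isAnalyticExtension_stieltjesExt (hβ : 0 < β)
    (hν : IntegrableOn (fun s : ℝ => 1 / (1 + s) ^ β) (Ioi 0) ν) {c₀ c₁ : ℝ} {f : ℝ → ℝ}
    (hf : ∀ x : ℝ, 0 < x → f x = c₀ / x ^ β + c₁ + ∫ s in Ioi (0 : ℝ), 1 / (x + s) ^ β ∂ν) :
    IsAnalyticExtension f (stieltjesExt β c₀ c₁ ν) :=
  ⟨differentiableOn_stieltjesExt hβ hν c₀ c₁, fun x hx => by
    rw [stieltjesExt_ofReal c₀ c₁ hx, hf x hx]⟩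

lemma IsAnalyticExtension.eqOn {f : ℝ → ℝ} {g g' : ℂ → ℂ} (hg : IsAnalyticExtension f g)
    (hg' : IsAnalyticExtension f g') : EqOn g g' Complex.slitPlane :=
  eqOn_of_eq_ofReal_pos Complex.isOpen_slitPlane
    (Complex.starConvex_one_slitPlane.isPathConnected
      Complex.one_mem_slitPlane).isConnected.isPreconnected
    Complex.one_mem_slitPlane hg.1 hg'.1 fun x hx => (hg.2 x hx).trans (hg'.2 x hx).symm

/-! ### The norm estimate for generalized Stieltjes functions -/

/-- The integrability condition on the Stieltjes measure makes it locally finite. -/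
lemma isLocallyFiniteMeasure_restrict (hβ : 0 < β)
    (hν : IntegrableOn (fun s : ℝ => 1 / (1 + s) ^ β) (Ioi 0) ν) :
    IsLocallyFiniteMeasure (ν.restrict (Ioi 0)) := by
  refine ⟨fun x => ⟨Iio (|x| + 1), Iio_mem_nhds (by linarith [le_abs_self x]), ?_⟩⟩
  have hpos : 0 < 1 / (1 + (|x| + 1)) ^ β := by positivity
  have hfin := hν.integrable.measure_ge_lt_top hpos
  refine lt_of_le_of_lt (measure_mono_ae ?_) hfin
  filter_upwards [ae_restrict_mem measurableSet_Ioi] with s hs hsx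
  have hs' : 0 < s := hs
  have hsx' : s < |x| + 1 := hsx
  change 1 / (1 + (|x| + 1)) ^ β ≤ 1 / (1 + s) ^ β
  exact one_div_le_one_div_of_le (by positivity)
    (Real.rpow_le_rpow (by positivity) (by linarith) hβ.le)

lemma integrableOn_one_div_add_rpow (hβ : 0 < β)
    (hν : IntegrableOn (fun s : ℝ => 1 / (1 + s) ^ β) (Ioi 0) ν) {x : ℝ} (hx : 0 < x) :
    IntegrableOn (fun s : ℝ => 1 / (x + s) ^ β) (Ioi 0) ν := by
  have h := (integrableOn_add_cpow_neg hβ hν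
    (Complex.ofReal_mem_slitPlane.2 hx : (x : ℂ) ∈ Complex.slitPlane)).integrable.norm
  refine h.congr ?_
  filter_upwards [ae_restrict_mem measurableSet_Ioi] with s hs
  have hs' : 0 < s := hs
  rw [← Complex.ofReal_neg, Complex.norm_cpow_real, ← Complex.ofReal_add, Complex.norm_real,
    Real.norm_of_nonneg (by positivity), Real.rpow_neg (by positivity), one_div]

lemma measure_Ioc_lt_top (hβ : 0 < β)
    (hν : IntegrableOn (fun s : ℝ => 1 / (1 + s) ^ β) (Ioi 0) ν) (x : ℝ) :
    ν (Ioc 0 x) < ∞ := by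
  have := isLocallyFiniteMeasure_restrict hβ hν
  have h : ν.restrict (Ioi 0) (Icc 0 x) < ∞ := isCompact_Icc.measure_lt_top
  rw [Measure.restrict_apply measurableSet_Icc] at h
  exact (measure_mono (fun s hs => ⟨⟨hs.1.le, hs.2⟩, hs.1⟩ :
    Ioc 0 x ⊆ Icc 0 x ∩ Ioi 0)).trans_lt h

lemma two_mul_rpow_le {s t : ℝ} (hβ : 0 < β) (hs : 0 < s) (ht : 0 < t) (hts : t ≤ s) :
    s ^ (-β) ≤ 2 ^ β * (1 / (t + s) ^ β) := by
  rw [Real.rpow_neg hs.le, mul_one_div, inv_eq_one_div, div_le_div_iff₀ (by positivity)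
    (by positivity), one_mul, ← Real.mul_rpow zero_le_two hs.le]
  exact Real.rpow_le_rpow (by positivity) (by linarith) hβ.le

lemma integrableOn_rpow_neg (hβ : 0 < β)
    (hν : IntegrableOn (fun s : ℝ => 1 / (1 + s) ^ β) (Ioi 0) ν) {x : ℝ} (hx : 0 < x) :
    IntegrableOn (fun s : ℝ => s ^ (-β)) (Ioi x) ν := by
  refine Integrable.mono' (((integrableOn_one_div_add_rpow hβ hν hx).mono_set
    (Ioi_subset_Ioi hx.le)).integrable.const_mul (2 ^ β))
    (by fun_prop : Measurable fun s : ℝ => s ^ (-β)).aestronglyMeasurable ?_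
  filter_upwards [ae_restrict_mem measurableSet_Ioi] with s hs
  have hs0 : 0 < s := hx.trans hs
  rw [Real.norm_of_nonneg (by positivity)]
  exact two_mul_rpow_le hβ hs0 hx (le_of_lt hs)

/-- The Stieltjes measure is split at `x`. Below `x` the kernel `(z + s) ^ (-β)` is written as
`z ^ (-β) * u β (z / s)`, above `x` as `s ^ (-β) * (1 + z / s) ^ (-β)`. -/
lemma laplaceBound_mul_stieltjesExt (hβ : 0 < β)
    (hν : IntegrableOn (fun s : ℝ => 1 / (1 + s) ^ β) (Ioi 0) ν) {c₀ c₁ : ℝ} (hc₀ : 0 ≤ c₀)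
    (hc₁ : 0 ≤ c₁) {F : ℂ → ℂ} {a b k : ℝ} (hF : LaplaceBound F a)
    (hzF : LaplaceBound (fun z => z ^ (-(β : ℂ)) * F z) b) (hu : LaplaceBound (u β) k)
    {x : ℝ} (hx : 0 < x) :
    LaplaceBound (fun z => F z * stieltjesExt β c₀ c₁ ν z)
      (c₀ * b + c₁ * a + b * (k * ν.real (Ioc 0 x)) + a * ∫ s in Ioi x, s ^ (-β) ∂ν) := by
  have := isLocallyFiniteMeasure_restrict hβ hν
  have hfin : IsFiniteMeasure (ν.restrict (Ioc 0 x)) :=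
    ⟨by rw [Measure.restrict_apply_univ]; exact measure_Ioc_lt_top hβ hν x⟩
  have hsf : SFinite (ν.restrict (Ioi x)) := by
    rw [← Measure.restrict_restrict_of_subset (Ioi_subset_Ioi hx.le)]
    infer_instance
  have h₀ : LaplaceBound (fun z => (c₀ : ℂ) * (z ^ (-(β : ℂ)) * F z)) (c₀ * b) := by
    simpa [abs_of_nonneg hc₀] using (laplaceBound_const (c₀ : ℂ)).mul hzF
  have h₁ : LaplaceBound (fun z => (c₁ : ℂ) * F z) (c₁ * a) := by
    simpa [abs_of_nonneg hc₁] using (laplaceBound_const (c₁ : ℂ)).mul hF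
  have h₂ := hu.mixture (ν := ν.restrict (Ioc 0 x)) (m := fun _ => 1)
    ((ae_restrict_mem measurableSet_Ioc).mono fun s hs => hs.1) (integrable_const 1)
    (Eventually.of_forall fun _ => zero_le_one)
  have h₃ := (laplaceBound_one_add_cpow_neg hβ).mixture (ν := ν.restrict (Ioi x))
    (m := fun s => s ^ (-β)) ((ae_restrict_mem measurableSet_Ioi).mono fun s hs => hx.trans hs)
    (integrableOn_rpow_neg hβ hν hx)
    ((ae_restrict_mem measurableSet_Ioi).mono fun s hs => Real.rpow_nonneg (hx.trans hs).le _)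
  have h := ((h₀.add h₁).add (hzF.mul h₂)).add (hF.mul h₃)
  rw [integral_const, smul_eq_mul, mul_one, measureReal_restrict_apply_univ, one_mul] at h
  refine h.congr fun z hz => ?_
  have hz0 : z ≠ 0 := fun h => by simp [h] at hz
  have hslit : z ∈ Complex.slitPlane := Or.inl hz
  have hre : ∀ s : ℝ, 0 < s → 0 < (z + s).re := fun s hs => by
    simp only [Complex.add_re, Complex.ofReal_re]; linarith
  have e₂ : ∀ s : ℝ, 0 < s → u β (z / s) = z ^ (β : ℂ) * (z + s) ^ (-(β : ℂ)) := fun s hs => by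
    have hs0 : (s : ℂ) ≠ 0 := by exact_mod_cast hs.ne'
    have hzs0 : z + s ≠ 0 := fun h => by have := hre s hs; simp [h] at this
    rw [u, show z / s / (z / s + 1) = z / (z + s) by field_simp, div_cpow_of_re_pos hz (hre s hs)]
  have e₃ : ∀ s : ℝ, 0 < s →
      ((s ^ (-β) : ℝ) : ℂ) * (1 + z / s) ^ (-(β : ℂ)) = (z + s) ^ (-(β : ℂ)) := fun s hs => by
    have hs0 : (s : ℂ) ≠ 0 := by exact_mod_cast hs.ne'
    rw [show 1 + z / s = (z + s) / s by field_simp; ring,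
      div_cpow_of_re_pos (hre s hs) (by simpa using hs), neg_neg, Complex.ofReal_cpow hs.le,
      Complex.ofReal_neg, mul_left_comm, ← Complex.cpow_add _ _ hs0]
    simp
  have i₂ : ∫ s in Ioc 0 x, ((1 : ℝ) : ℂ) * u β (z / s) ∂ν =
      z ^ (β : ℂ) * ∫ s in Ioc 0 x, (z + s) ^ (-(β : ℂ)) ∂ν := by
    rw [← integral_const_mul]
    refine setIntegral_congr_fun measurableSet_Ioc fun s hs => ?_
    simp only [Complex.ofReal_one, one_mul]
    exact e₂ s hs.1
  have i₃ : ∫ s in Ioi x, ((s ^ (-β) : ℝ) : ℂ) * (1 + z / s) ^ (-(β : ℂ)) ∂ν =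
      ∫ s in Ioi x, (z + s) ^ (-(β : ℂ)) ∂ν :=
    setIntegral_congr_fun measurableSet_Ioi fun s hs => e₃ s (hx.trans hs)
  have hint := integrableOn_add_cpow_neg hβ hν hslit
  have hsplit : ∫ s in Ioi (0 : ℝ), (z + s) ^ (-(β : ℂ)) ∂ν =
      ∫ s in Ioc 0 x, (z + s) ^ (-(β : ℂ)) ∂ν + ∫ s in Ioi x, (z + s) ^ (-(β : ℂ)) ∂ν := by
    rw [← Ioc_union_Ioi_eq_Ioi hx.le]
    exact setIntegral_union (Ioc_disjoint_Ioi le_rfl) measurableSet_Ioi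
      (hint.mono_set Ioc_subset_Ioi_self) (hint.mono_set (Ioi_subset_Ioi hx.le))
  have hone : z ^ (-(β : ℂ)) * z ^ (β : ℂ) = 1 := by
    rw [← Complex.cpow_add _ _ hz0]; simp
  rw [i₂, i₃, stieltjesExt, hsplit]
  linear_combination (-(F z) * ∫ s in Ioc 0 x, (z + s) ^ (-(β : ℂ)) ∂ν) * hone

/-- At the splitting point `x` given by `x ^ β = a / (b k)` the two bounds `b k` and `a s ^ (-β)`
agree, and their minimum is at most `2 ^ β a / (x + s) ^ β`. -/
lemma split_bound_le (hβ : 0 < β)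
    (hν : IntegrableOn (fun s : ℝ => 1 / (1 + s) ^ β) (Ioi 0) ν) {c₀ c₁ : ℝ} (hc₀ : 0 ≤ c₀)
    (hc₁ : 0 ≤ c₁) {a b k x : ℝ} (ha : 0 ≤ a) (hb : 0 ≤ b) (hk : 1 ≤ k) (hx : 0 < x)
    (hxβ : b * k = a * x ^ (-β)) :
    c₀ * b + c₁ * a + b * (k * ν.real (Ioc 0 x)) + a * ∫ s in Ioi x, s ^ (-β) ∂ν ≤
      2 ^ β * a * (c₀ / x ^ β + c₁ + ∫ s in Ioi (0 : ℝ), 1 / (x + s) ^ β ∂ν) := by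
  have h2 : (1 : ℝ) ≤ 2 ^ β := Real.one_le_rpow one_le_two hβ.le
  have hint := integrableOn_one_div_add_rpow hβ hν hx
  have hfin : IsFiniteMeasure (ν.restrict (Ioc 0 x)) :=
    ⟨by rw [Measure.restrict_apply_univ]; exact measure_Ioc_lt_top hβ hν x⟩
  have hsplit : ∫ s in Ioi (0 : ℝ), 1 / (x + s) ^ β ∂ν =
      ∫ s in Ioc 0 x, 1 / (x + s) ^ β ∂ν + ∫ s in Ioi x, 1 / (x + s) ^ β ∂ν := by
    rw [← Ioc_union_Ioi_eq_Ioi hx.le]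
    exact setIntegral_union (Ioc_disjoint_Ioi le_rfl) measurableSet_Ioi
      (hint.mono_set Ioc_subset_Ioi_self) (hint.mono_set (Ioi_subset_Ioi hx.le))
  have hlow : x ^ (-β) * ν.real (Ioc 0 x) ≤ 2 ^ β * ∫ s in Ioc 0 x, 1 / (x + s) ^ β ∂ν := by
    have e : x ^ (-β) * ν.real (Ioc 0 x) = ∫ s in Ioc 0 x, x ^ (-β) ∂ν := by
      rw [integral_const, smul_eq_mul, measureReal_restrict_apply_univ, mul_comm]
    rw [e, ← integral_const_mul]
    refine setIntegral_mono_on (integrable_const _)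
      ((hint.mono_set Ioc_subset_Ioi_self).integrable.const_mul _) measurableSet_Ioc fun s hs => ?_
    rw [add_comm x s]
    exact two_mul_rpow_le hβ hx hs.1 hs.2
  have hhigh : ∫ s in Ioi x, s ^ (-β) ∂ν ≤ 2 ^ β * ∫ s in Ioi x, 1 / (x + s) ^ β ∂ν := by
    rw [← integral_const_mul]
    exact setIntegral_mono_on (integrableOn_rpow_neg hβ hν hx)
      ((hint.mono_set (Ioi_subset_Ioi hx.le)).integrable.const_mul _) measurableSet_Ioi
      fun s hs => two_mul_rpow_le hβ (hx.trans hs) hx (le_of_lt hs)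
  have t₀ : c₀ * b ≤ 2 ^ β * a * (c₀ / x ^ β) := by
    have h1 : c₀ * b ≤ c₀ * (b * k) :=
      mul_le_mul_of_nonneg_left (le_mul_of_one_le_right hb hk) hc₀
    rw [hxβ] at h1
    have h3 : 0 ≤ c₀ * (a * x ^ (-β)) := by positivity
    have h4 : 2 ^ β * a * (c₀ / x ^ β) = 2 ^ β * (c₀ * (a * x ^ (-β))) := by
      rw [Real.rpow_neg hx.le]; ring
    rw [h4]
    exact h1.trans (le_mul_of_one_le_left h3 h2)
  have t₁ : c₁ * a ≤ 2 ^ β * a * c₁ := by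
    have h3 : 0 ≤ c₁ * a := by positivity
    linarith [le_mul_of_one_le_left h3 h2]
  have t₂ : b * (k * ν.real (Ioc 0 x)) ≤ 2 ^ β * a * ∫ s in Ioc 0 x, 1 / (x + s) ^ β ∂ν := by
    rw [← mul_assoc, hxβ]
    linarith [mul_le_mul_of_nonneg_left hlow ha]
  have t₃ : a * ∫ s in Ioi x, s ^ (-β) ∂ν ≤ 2 ^ β * a * ∫ s in Ioi x, 1 / (x + s) ^ β ∂ν := by
    linarith [mul_le_mul_of_nonneg_left hhigh ha]
  rw [hsplit]
  linarith

end

/-- Powers of the splitting point `(a / (b k)) ^ (1 / β)`; for `α = β` the value is `b k / a`. -/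
lemma rpow_neg_split_point {β a b k : ℝ} (ha : 0 < a) (hb : 0 < b) (hk : 0 < k)
    (α : ℝ) :
    ((a / b) ^ (1 / β) * k ^ (-(1 / β))) ^ (-α) = k ^ (α / β) * a ^ (-(α / β)) * b ^ (α / β) := by
  rw [Real.mul_rpow (by positivity) (by positivity), ← Real.rpow_mul (by positivity),
    ← Real.rpow_mul (by positivity), Real.div_rpow ha.le hb.le, div_eq_mul_inv,
    ← Real.rpow_neg hb.le]
  have e1 : 1 / β * -α = -(α / β) := by ring
  have e2 : -(1 / β) * -α = α / β := by ring
  rw [e1, e2, neg_neg]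
  ring

/-- The norm estimate for a nonzero `F`: `laplaceBound_mul_stieltjesExt` is applied with bounds `a + ε`,
`b + ε`, `c β + ε` at the fixed splitting point, and `ε` tends to `0`. -/
lemma normA_mul_stieltjes_le {β : ℝ} (hβ : 0 < β) {F : ℂ → ℂ} (hF : MemA F)
    (hzF : MemA (fun z => z ^ (-(β : ℂ)) * F z)) (ha : 0 < normA F)
    (hb : 0 < normA (fun z => z ^ (-(β : ℂ)) * F z)) {f : ℝ → ℝ} (hf : IsGenStieltjes β f)
    {g : ℂ → ℂ} (hg : IsAnalyticExtension f g) :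
    MemA (fun z => F z * g z) ∧ normA (fun z => F z * g z) ≤ 2 ^ β * normA F *
      f ((normA F / normA (fun z => z ^ (-(β : ℂ)) * F z)) ^ (1 / β) * c β ^ (-(1 / β))) := by
  obtain ⟨c₀, c₁, ν, hc₀, hc₁, hν, hf⟩ := hf
  have hc := one_le_c hβ
  have hc0 : 0 < c β := by linarith
  set a := normA F with ha_def
  set b := normA (fun z => z ^ (-(β : ℂ)) * F z) with hb_def
  set x := (a / b) ^ (1 / β) * c β ^ (-(1 / β)) with hx_def
  have hx : 0 < x := by positivity
  have hEq := hg.eqOn (isAnalyticExtension_stieltjesExt hβ hν hf)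
  have hbound : ∀ ε : ℝ, 0 < ε → LaplaceBound (fun z => F z * g z)
      (c₀ * (b + ε) + c₁ * (a + ε) + (b + ε) * ((c β + ε) * ν.real (Ioc 0 x)) +
        (a + ε) * ∫ s in Ioi x, s ^ (-β) ∂ν) := fun ε hε => by
    refine (laplaceBound_mul_stieltjesExt hβ hν hc₀ hc₁ (hF.laplaceBound (by linarith))
      (hzF.laplaceBound (by linarith)) ((memA_u hβ).laplaceBound (r := c β + ε) ?_) hx).congr
      fun z hz => ?_
    · change c β < c β + ε
      linarith
    · rw [hEq (Or.inl hz)]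
  refine ⟨(hbound 1 one_pos).memA, ?_⟩
  have hxβ : b * c β = a * x ^ (-β) := by
    rw [hx_def, rpow_neg_split_point ha hb hc0, div_self hβ.ne', Real.rpow_one, Real.rpow_one,
      Real.rpow_neg_one]
    field_simp
  rw [hf x hx]
  refine le_trans ?_ (split_bound_le hβ hν hc₀ hc₁ ha.le hb.le hc hx hxβ)
  have hcont : Continuous fun ε : ℝ => c₀ * (b + ε) + c₁ * (a + ε) +
      (b + ε) * ((c β + ε) * ν.real (Ioc 0 x)) + (a + ε) * ∫ s in Ioi x, s ^ (-β) ∂ν := by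
    fun_prop
  have ht := (hcont.tendsto 0).mono_left (nhdsWithin_le_nhds (s := Ioi (0 : ℝ)))
  simp only [add_zero] at ht
  refine ge_of_tendsto ht ?_
  filter_upwards [self_mem_nhdsWithin] with ε hε
  exact (hbound ε hε).normA_le

/-! ### Negative powers as generalized Stieltjes functions -/

lemma integrableOn_rpow_div_one_add_rpow {α β : ℝ} (hα : 0 < α) (hαβ : α < β) :
    IntegrableOn (fun t : ℝ => t ^ (β - α - 1) / (1 + t) ^ β) (Ioi 0) := by
  have hβ : 0 < β := hα.trans hαβ
  have hm : Measurable fun t : ℝ => t ^ (β - α - 1) / (1 + t) ^ β := by fun_prop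
  rw [← Ioc_union_Ioi_eq_Ioi zero_le_one]
  refine IntegrableOn.union ?_ ?_
  · have h1 : IntegrableOn (fun t : ℝ => t ^ (β - α - 1)) (Ioc 0 1) := by
      rw [integrableOn_Ioc_iff_integrableOn_Ioo, intervalIntegral.integrableOn_Ioo_rpow_iff one_pos]
      linarith
    refine Integrable.mono' h1 hm.aestronglyMeasurable ?_
    filter_upwards [ae_restrict_mem measurableSet_Ioc] with t ht
    have ht0 : 0 < t := ht.1
    rw [Real.norm_of_nonneg (by positivity)]
    exact div_le_self (by positivity) (Real.one_le_rpow (by linarith) hβ.le)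
  · have h1 : IntegrableOn (fun t : ℝ => t ^ (-α - 1)) (Ioi 1) :=
      integrableOn_Ioi_rpow_of_lt (by linarith) one_pos
    refine Integrable.mono' h1 hm.aestronglyMeasurable ?_
    filter_upwards [ae_restrict_mem measurableSet_Ioi] with t ht
    have ht0 : 0 < t := one_pos.trans ht
    rw [Real.norm_of_nonneg (by positivity), div_le_iff₀ (by positivity)]
    calc t ^ (β - α - 1) = t ^ (-α - 1) * t ^ β := by
          rw [← Real.rpow_add ht0]; ring_nf
      _ ≤ t ^ (-α - 1) * (1 + t) ^ β := by gcongr; linarith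

/-- By scaling, `∫ s ^ (β - α - 1) / (x + s) ^ β ds` is a constant multiple of `x ^ (-α)`. -/
lemma integral_rpow_div_add_rpow {α β x : ℝ} (hx : 0 < x) :
    ∫ s in Ioi (0 : ℝ), s ^ (β - α - 1) / (x + s) ^ β =
      x ^ (-α) * ∫ t in Ioi (0 : ℝ), t ^ (β - α - 1) / (1 + t) ^ β := by
  have h := integral_comp_mul_left_Ioi (fun s : ℝ => s ^ (β - α - 1) / (x + s) ^ β) 0 hx
  rw [mul_zero, smul_eq_mul, eq_inv_mul_iff_mul_eq₀ hx.ne'] at h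
  rw [← h, ← integral_const_mul, ← integral_const_mul]
  refine setIntegral_congr_fun measurableSet_Ioi fun t ht => ?_
  have ht0 : 0 < t := ht
  change x * ((x * t) ^ (β - α - 1) / (x + x * t) ^ β) =
    x ^ (-α) * (t ^ (β - α - 1) / (1 + t) ^ β)
  rw [show x + x * t = x * (1 + t) by ring, Real.mul_rpow hx.le ht0.le,
    Real.mul_rpow hx.le (by positivity),
    show β - α - 1 = β + -α - 1 by ring, Real.rpow_sub_one hx.ne', Real.rpow_add hx]
  field_simp

lemma isGenStieltjes_rpow_neg {α β : ℝ} (hα : 0 < α) (hαβ : α < β) :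
    IsGenStieltjes β (fun x => x ^ (-α)) := by
  have hint := integrableOn_rpow_div_one_add_rpow hα hαβ
  set C := ∫ t in Ioi (0 : ℝ), t ^ (β - α - 1) / (1 + t) ^ β with hC
  have hC0 : 0 < C := by
    refine (setIntegral_pos_iff_support_of_nonneg_ae ?_ hint).2 ?_
    · filter_upwards [ae_restrict_mem measurableSet_Ioi] with t ht
      have ht0 : 0 < t := ht
      simp only [Pi.zero_apply]
      positivity
    · have : Ioi (0 : ℝ) ⊆
          Function.support (fun t : ℝ => t ^ (β - α - 1) / (1 + t) ^ β) ∩ Ioi 0 := fun t ht => by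
        have ht0 : 0 < t := ht
        refine ⟨ne_of_gt ?_, ht⟩
        positivity
      exact lt_of_lt_of_le (by simp) (measure_mono this)
  let d : ℝ → ℝ := fun s => C⁻¹ * s ^ (β - α - 1)
  have hdm : Measurable d := by fun_prop
  have hd : ∀ s ∈ Ioi (0 : ℝ), 0 ≤ d s := fun s hs => by
    have : 0 < s := hs
    positivity
  let ν : Measure ℝ := volume.withDensity fun s => ENNReal.ofReal (d s)
  have hres : ν.restrict (Ioi 0) =
      (volume.restrict (Ioi 0)).withDensity fun s => ENNReal.ofReal (d s) :=
    restrict_withDensity measurableSet_Ioi _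
  refine ⟨0, 0, ν, le_rfl, le_rfl, ?_, fun x hx => ?_⟩
  · rw [IntegrableOn, hres, integrable_withDensity_iff_integrable_smul' hdm.ennreal_ofReal
      (Eventually.of_forall fun _ => ENNReal.ofReal_lt_top)]
    refine (hint.integrable.const_mul C⁻¹).congr ?_
    filter_upwards [ae_restrict_mem measurableSet_Ioi] with s hs
    rw [ENNReal.toReal_ofReal (hd s hs), smul_eq_mul]
    ring
  · rw [hres, integral_withDensity_eq_integral_toReal_smul hdm.ennreal_ofReal
      (Eventually.of_forall fun _ => ENNReal.ofReal_lt_top)]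
    have e : ∫ s in Ioi (0 : ℝ), (ENNReal.ofReal (d s)).toReal • (1 / (x + s) ^ β) =
        C⁻¹ * ∫ s in Ioi (0 : ℝ), s ^ (β - α - 1) / (x + s) ^ β := by
      rw [← integral_const_mul]
      refine setIntegral_congr_fun measurableSet_Ioi fun s hs => ?_
      simp only [ENNReal.toReal_ofReal (hd s hs), smul_eq_mul, d]
      ring
    rw [e, integral_rpow_div_add_rpow hx, ← hC]
    field_simp
    simp

lemma isAnalyticExtension_cpow_neg (α : ℝ) :
    IsAnalyticExtension (fun x => x ^ (-α)) (fun z => z ^ (-(α : ℂ))) :=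
  ⟨fun z hz => (differentiableAt_id.cpow (differentiableAt_const _) hz).differentiableWithinAt,
    fun x hx => by rw [Complex.ofReal_cpow hx.le, Complex.ofReal_neg]⟩

end LaplaceAlgebra

open LaplaceAlgebra in
theorem theorem4p2 (β : ℝ) (hβ : 0 < β) (F : ℂ → ℂ) (a b : ℝ)
    (hF : LaplaceAlgebra.MemA F)
    (hzF : LaplaceAlgebra.MemA (fun z => z ^ (-(β : ℂ)) * F z))
    (ha : LaplaceAlgebra.normA F = a)
    (hb : LaplaceAlgebra.normA (fun z => z ^ (-(β : ℂ)) * F z) = b) :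
    -- the constant `c β` is the norm of an element of the algebra
    LaplaceAlgebra.MemA (LaplaceAlgebra.u β) ∧
    -- every generalized Stieltjes function `f` of order `β` extends analytically to `ℂ \ (-∞,0]`,
    -- and `F` times the extension `g` belongs to the algebra, with the norm estimate
    (∀ f : ℝ → ℝ, LaplaceAlgebra.IsGenStieltjes β f →
      (∃ g : ℂ → ℂ, LaplaceAlgebra.IsAnalyticExtension f g) ∧
      ∀ g : ℂ → ℂ, LaplaceAlgebra.IsAnalyticExtension f g →
        LaplaceAlgebra.MemA (fun z => F z * g z) ∧
        LaplaceAlgebra.normA (fun z => F z * g z) ≤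
          2 ^ β * a * f ((a / b) ^ (1 / β) * LaplaceAlgebra.c β ^ (-(1 / β)))) ∧
    -- the interpolation inequality for the powers `z ^ (-α)`
    (∀ α : ℝ, 0 ≤ α → α ≤ β →
      LaplaceAlgebra.MemA (fun z => z ^ (-(α : ℂ)) * F z) ∧
      LaplaceAlgebra.normA (fun z => z ^ (-(α : ℂ)) * F z) ≤
        2 ^ β * LaplaceAlgebra.c β ^ (α / β) * a ^ (1 - α / β) * b ^ (α / β)) := by
  have hu := memA_u hβ
  have hc := one_le_c hβ
  have hc0 : 0 < c β := by linarith
  have h2 : (1 : ℝ) ≤ 2 ^ β := Real.one_le_rpow one_le_two hβ.le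
  have ha0 : 0 ≤ a := ha ▸ normA_nonneg F
  have hb0 : 0 ≤ b := hb ▸ normA_nonneg _
  -- either both norms are positive, or `F` vanishes on `ℂ₊`
  have hdich : (0 < a ∧ 0 < b) ∨ (a = 0 ∧ ∀ z : ℂ, 0 < z.re → F z = 0) := by
    by_cases hz : ∀ z : ℂ, 0 < z.re → F z = 0
    · refine Or.inr ⟨le_antisymm ?_ ha0, hz⟩
      rw [← ha]
      exact ((laplaceBound_const 0).congr hz).normA_le.trans_eq norm_zero
    · push Not at hz
      obtain ⟨z, hz, hFz⟩ := hz
      have hz0 : z ≠ 0 := fun h => by simp [h] at hz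
      refine Or.inl ⟨?_, ?_⟩
      · rw [← ha]
        exact (norm_pos_iff.2 hFz).trans_le (hF.norm_le hz)
      · rw [← hb]
        exact (norm_pos_iff.2 (mul_ne_zero (by simp [Complex.cpow_eq_zero_iff, hz0]) hFz)).trans_le
          (hzF.norm_le hz)
  have hzero : (∀ z : ℂ, 0 < z.re → F z = 0) → ∀ g : ℂ → ℂ, LaplaceBound (fun z => F z * g z) 0 :=
    fun hz g => ((laplaceBound_const 0).congr fun z hz' => by simp [hz z hz']).mono norm_zero.le
  have hstieltjes : ∀ f : ℝ → ℝ, IsGenStieltjes β f → ∀ g : ℂ → ℂ, IsAnalyticExtension f g →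
      MemA (fun z => F z * g z) ∧ normA (fun z => F z * g z) ≤
        2 ^ β * a * f ((a / b) ^ (1 / β) * c β ^ (-(1 / β))) := by
    intro f hf g hg
    rcases hdich with ⟨ha', hb'⟩ | ⟨ha', hz⟩
    · subst ha hb
      exact normA_mul_stieltjes_le hβ hF hzF ha' hb' hf hg
    · refine ⟨(hzero hz g).memA, ?_⟩
      rw [ha']
      simpa using (hzero hz g).normA_le
  refine ⟨hu, fun f hf => ⟨?_, hstieltjes f hf⟩, fun α hα hαβ => ?_⟩
  · obtain ⟨c₀, c₁, ν, -, -, hν, hf⟩ := hf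
    exact ⟨_, isAnalyticExtension_stieltjesExt hβ hν hf⟩
  rcases hdich with ⟨ha', hb'⟩ | ⟨ha', hz⟩
  · rcases hα.eq_or_lt with rfl | hα
    · have e : (fun z => z ^ (-((0 : ℝ) : ℂ)) * F z) = F := by ext z; simp
      rw [e, ha]
      refine ⟨hF, ?_⟩
      simpa using le_mul_of_one_le_left ha0 h2
    rcases hαβ.eq_or_lt with rfl | hαβ
    · refine ⟨hzF, ?_⟩
      rw [hb, div_self hβ.ne', sub_self, Real.rpow_one, Real.rpow_zero, Real.rpow_one, mul_one]
      exact le_mul_of_one_le_left hb0 (one_le_mul_of_one_le_of_one_le h2 hc)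
    have h := hstieltjes _ (isGenStieltjes_rpow_neg hα hαβ) _ (isAnalyticExtension_cpow_neg α)
    simp only [rpow_neg_split_point ha' hb' hc0, mul_comm (F _)] at h
    refine ⟨h.1, h.2.trans_eq ?_⟩
    rw [sub_eq_add_neg, Real.rpow_add ha', Real.rpow_one]
    ring
  · have h := hzero hz fun z => z ^ (-(α : ℂ))
    simp only [mul_comm (F _)] at h
    exact ⟨h.memA, h.normA_le.trans (by positivity)⟩
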